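/- **Theorem (Validity).** *System.* Consider $N\ge 1$ processes $P_0,\dots,P_{N-1}$, a static set of at most $f=\lfloor (N-1)/3\rfloor$ of which is faulty (Byzantine); the others are correct. Channels are asynchronous: messages between correct processes are neither forged nor modified and eventually arrive. Correct processes follow the Alea-BFT protocol below, are never halted, and handle each event atomically. *Protocol at $P_i$.* The state consists of the set $S_i$ of delivered messages, the set of delivered proposals (finite sets of messages), a buffer $buf_i$ and a counter $priority_i$, initially $\emptyset$ and $0$, and $N$ priority queues $Q_0,\dots,Q_{N-1}$. A queue has slots $0,1,2,\dots$; a slot is empty, full, or removed (permanently used), and the *head* is the lowest slot that is not removed. Enqueueing into a used slot has no effect, and dequeuing $V$ removes all occurrences of $V$. - On receiving a client message $m\notin S_i$, add $m$ to $buf_i$; if then $|buf_i|=B$, input $buf_i$ to $\mathrm{VCBC}(i,priority_i)$, empty $buf_i$ and increase $priority_i$ by one. - When $\mathrm{VCBC}(j,s)$ outputs $V$, enqueue $V$ in slot $s$ of $Q_j$, and dequeue it at once if the proposal $V$ has already been delivered. - In rounds $r=0,1,2,\dots$: input $1$ to $\mathrm{ABA}(r)$ if the head slot of $Q_{F(r)}$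 is full and $0$ otherwise, and wait for the decision. On $0$ go to the next round. On $1$: if the head slot of $Q_{F(r)}$ is empty, broadcast $\langle\textsc{fill-gap},F(r),\text{head}\rangle$; wait until the head slot contains a value $V$; dequeue $V$ from all queues, output (deliver) every $m\in V$ with $m\notin S_i$, add the messages of $V$ to $S_i$ and $V$ to the delivered proposals, and go to the next round. - On $\langle\textsc{fill-gap},q,s\rangle$ from $P_k$, if the own head of $Q_q$ is at least $s$, send $P_k$ a $\textsc{filler}$ message with the verifiable messages of all $\mathrm{VCBC}(q,s')$ already output, $s\le s'\le\text{head}$. On a $\textsc{filler}$ message, hand its entries to the corresponding VCBC instances. Here $B$ is the batch size and $F:\mathbb N\to\{0,\dots,N-1\}$ is any function that takes every value infinitely often (e.g. round robin). *Building blocks.* Every instance $\mathrm{VCBC}(j,s)$, with sender $P_j$, satisfies: *validity* (if $P_j$ is correct and inputs $V$, all correct processes eventually output $V$); *consistency* (no two correct processes output different values); *integrity* (each correct process outputs at most once, and if the sender is correct, only a value that it input before); *verifiability* (a correct process that has output $V$ holds a verifiable message that makes every correct process to which it is subsequently handed output $V$). Every instance $\mathrm{ABA}(r)$ satisfies: *agreement*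 (correct processes do not decide differently); *validity* (a value decided by a correct process has before been proposed by a correct process); *probabilistic termination* (for each correct process, the probability that all correct processes have an input to the instance and that it is undecided after $k$ internal rounds of the instance tends to $0$ as $k\to\infty$). An execution is random, for an arbitrary adversary; all properties other than termination hold almost surely. *Claim.* With probability one: if a correct process broadcasts a message $m$, then some correct process eventually delivers $m$. Here a process broadcasts $m$ if it inputs a proposal containing $m$ to one of its VCBC instances, or if it receives $m$ from a client and the batch being collected at that time is eventually filled (which is automatic when $B=1$). -/

import Mathlib

open MeasureTheory Filter Topology

namespace Alea

/-! ### Priority queues -/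

/-- A slot of a priority queue. Once removed, it is permanently used. -/
inductive Slot (V : Type*) where
  | empty : Slot V
  | full (v : V) : Slot V
  | removed : Slot V

/-- A priority queue, as the contents of its slots, one for each priority value. -/
abbrev PQueue (V : Type*) := ℕ → Slot V

namespace PQueue

variable {V : Type*}

def new : PQueue V := fun _ => Slot.empty

/-- The head slot: the lowest slot that has not been removed. -/
noncomputable def head (Q : PQueue V) : ℕ := sInf {s | Q s ≠ Slot.removed}

/-- Store `v` in slot `s`; ignored if the slot has already been used. -/
def enqueue (Q : PQueue V) (s : ℕ) (v : V) : PQueue V := fun s' =>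
  if s' = s then
    match Q s with
    | Slot.empty => Slot.full v
    | x => x
  else Q s'

open Classical in
/-- Remove all instances of `v`. -/
noncomputable def dequeue (Q : PQueue V) (v : V) : PQueue V := fun s =>
  if Q s = Slot.full v then Slot.removed else Q s

/-- The content of the head slot, `none` if that slot is empty. -/
noncomputable def peek (Q : PQueue V) : Option V :=
  match Q Q.head with
  | Slot.full v => some v
  | _ => none

end PQueue

/-! ### Local states, events and actions of a correct process

`N` is the number of processes, `M` the type of messages; proposals (batches) are finite sets of
messages. `W` is the type of verifiable VCBC protocol messages. -/

/-- Control point of the agreement loop: about to start a round; waiting for the ABA decision of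
the current round; waiting, after decision `1`, for the head slot to contain a value. -/
inductive Phase where
  | start : Phase
  | waitABA : Phase
  | waitValue : Phase

structure LState (N : ℕ) (M W : Type*) where
  /-- messages delivered so far -/
  S : Set M
  /-- proposals (batches) delivered so far -/
  batches : Set (Finset M)
  /-- pending client messages -/
  buf : Finset M
  /-- sequence number of the next own proposal -/
  priority : ℕ
  queues : Fin N → PQueue (Finset M)
  /-- the verifiable message of each VCBC instance that has been output -/
  proof : Fin N → ℕ → Option W
  round : ℕ
  phase : Phase
  /-- the ABA decisions received so far -/
  decision : ℕ → Option Bool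

/-- The state after `START`. -/
def LState.initial (N : ℕ) (M W : Type*) : LState N M W where
  S := ∅
  batches := ∅
  buf := ∅
  priority := 0
  queues := fun _ => PQueue.new
  proof := fun _ _ => none
  round := 0
  phase := Phase.start
  decision := fun _ => none

/-- Point-to-point messages of the recovery sub-protocol. -/
inductive Msg (N : ℕ) (W : Type*) where
  | fillGap (q : Fin N) (s : ℕ) : Msg N W
  | filler (entries : List (Fin N × ℕ × W)) : Msg N W

/-- What can happen at a process. -/
inductive Event (N : ℕ) (M W : Type*) where
  /-- reception of a message from a client -/
  | client (m : M) : Event N M W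
  /-- `VCBC (j, s)` outputs `V`, with the verifiable message `w` -/
  | vcbcOut (j : Fin N) (s : ℕ) (V : Finset M) (w : W) : Event N M W
  /-- `ABA (r)` decides `b`, in its `k`-th internal round -/
  | abaOut (r k : ℕ) (b : Bool) : Event N M W
  /-- reception of `x` from process `k` -/
  | receive (k : Fin N) (x : Msg N W) : Event N M W
  /-- the agreement loop is scheduled -/
  | tick : Event N M W

/-- What a process does in reaction to an event. -/
inductive Action (N : ℕ) (M W : Type*) where
  /-- input `V` to `VCBC (own identifier, s)` -/
  | vcbcIn (s : ℕ) (V : Finset M) : Action N M W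
  /-- hand the verifiable message `w` to `VCBC (j, s)` -/
  | vcbcProof (j : Fin N) (s : ℕ) (w : W) : Action N M W
  /-- input `b` to `ABA (r)` -/
  | abaIn (r : ℕ) (b : Bool) : Action N M W
  /-- send `x` to process `k` -/
  | send (k : Fin N) (x : Msg N W) : Action N M W
  /-- output `m` to the application -/
  | deliver (m : M) : Action N M W

/-! ### The protocol -/

section Protocol

variable {N : ℕ} {M W : Type*}

open Classical in
/-- Broadcast component, reception of a client message; `B` is the batch size. -/
noncomputable def onClient (B : ℕ) (m : M) (σ : LState N M W) :
    LState N M W × List (Action N M W) :=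
  if m ∈ σ.S then (σ, [])
  else if (insert m σ.buf).card = B then
    ({ σ with buf := ∅, priority := σ.priority + 1 },
      [Action.vcbcIn σ.priority (insert m σ.buf)])
  else ({ σ with buf := insert m σ.buf }, [])

open Classical in
/-- Broadcast component, output of `V` by `VCBC (j, s)`: the proposal is put into slot `s` of the
queue of `j`, and removed at once if this proposal has already been delivered. -/
noncomputable def onVCBC (j : Fin N) (s : ℕ) (V : Finset M) (w : W) (σ : LState N M W) :
    LState N M W × List (Action N M W) :=
  let Q := (σ.queues j).enqueue s V
  ({ σ with
      queues := Function.update σ.queues j (if V ∈ σ.batches then Q.dequeue V else Q)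
      proof := Function.update σ.proof j (Function.update (σ.proof j) s (some w)) }, [])

/-- Recording an ABA decision, which the agreement loop reads. -/
def onABA (r : ℕ) (b : Bool) (σ : LState N M W) : LState N M W × List (Action N M W) :=
  ({ σ with decision := Function.update σ.decision r (some b) }, [])

/-- Recovery: answering a `FILL-GAP` request of `k` for queue `q` from slot `s` on, if the own
head is not behind, with the verifiable messages of the slots from `s` to the own head. -/
noncomputable def onFillGap (k q : Fin N) (s : ℕ) (σ : LState N M W) :
    LState N M W × List (Action N M W) :=
  if s ≤ (σ.queues q).head then
    (σ, [Action.send k (Msg.filler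
      ((List.range' s ((σ.queues q).head + 1 - s)).filterMap
        (fun s' => (σ.proof q s').map (fun w => (q, s', w)))))])
  else (σ, [])

/-- Recovery: handing the entries of a `FILLER` message to their VCBC instances. -/
def onFiller (entries : List (Fin N × ℕ × W)) (σ : LState N M W) :
    LState N M W × List (Action N M W) :=
  (σ, entries.map (fun e => Action.vcbcProof e.1 e.2.1 e.2.2))

open Classical in
/-- `AC-DELIVER`: remove the proposal `V` from all queues and output its messages, except those
that have been output before. -/
noncomputable def acDeliver (V : Finset M) (σ : LState N M W) :
    LState N M W × List (Action N M W) :=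
  ({ σ with
      queues := fun j => (σ.queues j).dequeue V
      batches := insert V σ.batches
      S := σ.S ∪ {m | m ∈ V} },
    (V.toList.filter (fun m => decide (m ∉ σ.S))).map Action.deliver)

/-- One step of the agreement loop; nothing happens while its wait condition is false. -/
noncomputable def onTick (F : ℕ → Fin N) (σ : LState N M W) :
    LState N M W × List (Action N M W) :=
  let Q := σ.queues (F σ.round)
  match σ.phase with
  | Phase.start =>
      ({ σ with phase := Phase.waitABA }, [Action.abaIn σ.round Q.peek.isSome])
  | Phase.waitABA =>
      match σ.decision σ.round with
      | none => (σ, [])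
      | some false => ({ σ with round := σ.round + 1, phase := Phase.start }, [])
      | some true =>
          ({ σ with phase := Phase.waitValue },
            match Q.peek with
            | some _ => []
            | none => (List.finRange N).map
                (fun k => Action.send k (Msg.fillGap (F σ.round) Q.head)))
  | Phase.waitValue =>
      match Q.peek with
      | none => (σ, [])
      | some V =>
          let d := acDeliver V σ
          ({ d.1 with round := σ.round + 1, phase := Phase.start }, d.2)

/-- The code of the protocol: new local state and actions. -/
noncomputable def step (B : ℕ) (F : ℕ → Fin N) (σ : LState N M W) :
    Event N M W → LState N M W × List (Action N M W)
  | Event.client m => onClient B m σ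
  | Event.vcbcOut j s V w => onVCBC j s V w σ
  | Event.abaOut r _ b => onABA r b σ
  | Event.receive k (Msg.fillGap q s) => onFillGap k q s σ
  | Event.receive _ (Msg.filler entries) => onFiller entries σ
  | Event.tick => onTick F σ

end Protocol

/-! ### Runs -/

/-- A run: at time `t`, the event `event t` happens at process `proc t`. -/
structure Run (N : ℕ) (M W : Type*) where
  proc : ℕ → Fin N
  event : ℕ → Event N M W
  state : ℕ → Fin N → LState N M W

section Spec

variable {N : ℕ} {M W : Type*}

namespace Run

/-- The event `e` happens at process `p` at time `t`. -/
def Occurs (R : Run N M W) (t : ℕ) (p : Fin N) (e : Event N M W) : Prop :=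
  R.proc t = p ∧ R.event t = e

/-- Process `p`, following the protocol, performs the action `a` at time `t`. -/
def Does (B : ℕ) (F : ℕ → Fin N) (R : Run N M W) (t : ℕ) (p : Fin N) (a : Action N M W) : Prop :=
  R.proc t = p ∧ a ∈ (step B F (R.state t p) (R.event t)).2

end Run

/-- The correct processes follow the protocol, and the agreement loop of each of them is scheduled
again and again. Nothing is required of the other processes. -/
structure Follows (correct : Finset (Fin N)) (B : ℕ) (F : ℕ → Fin N) (R : Run N M W) : Prop where
  start : ∀ p ∈ correct, R.state 0 p = LState.initial N M W
  next : ∀ p ∈ correct, ∀ t, R.proc t = p →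
    R.state (t + 1) p = (step B F (R.state t p) (R.event t)).1
  idle : ∀ p ∈ correct, ∀ t, R.proc t ≠ p → R.state (t + 1) p = R.state t p
  fair : ∀ p ∈ correct, ∀ t, ∃ t' ≥ t, R.Occurs t' p Event.tick

/-- Asynchronous authenticated channels: between correct processes messages are neither forged nor
modified, and they eventually arrive. Faulty processes may send anything at any time. -/
structure ReliableLinks (correct : Finset (Fin N)) (B : ℕ) (F : ℕ → Fin N) (R : Run N M W) :
    Prop where
  authentic : ∀ p ∈ correct, ∀ q ∈ correct, ∀ t x, R.Occurs t q (Event.receive p x) →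
    ∃ t' < t, R.Does B F t' p (Action.send q x)
  reliable : ∀ p ∈ correct, ∀ q ∈ correct, ∀ t x, R.Does B F t p (Action.send q x) →
    ∃ t' > t, R.Occurs t' q (Event.receive p x)

/-- Verifiable consistent broadcast, for all instances `(j, s)` with sender `j`. -/
structure VCBCSpec (correct : Finset (Fin N)) (B : ℕ) (F : ℕ → Fin N) (R : Run N M W) :
    Prop where
  validity : ∀ j ∈ correct, ∀ s V t, R.Does B F t j (Action.vcbcIn s V) →
    ∀ p ∈ correct, ∃ t' w, R.Occurs t' p (Event.vcbcOut j s V w)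
  consistency : ∀ p ∈ correct, ∀ q ∈ correct, ∀ j s V V' w w' t t',
    R.Occurs t p (Event.vcbcOut j s V w) → R.Occurs t' q (Event.vcbcOut j s V' w') → V = V'
  /-- at most one output by each correct process -/
  integrity : ∀ p ∈ correct, ∀ j s V V' w w' t t',
    R.Occurs t p (Event.vcbcOut j s V w) → R.Occurs t' p (Event.vcbcOut j s V' w') → t = t'
  /-- the output of an instance with a correct sender was input by it before -/
  integrity_sender : ∀ p ∈ correct, ∀ j ∈ correct, ∀ s V w t,
    R.Occurs t p (Event.vcbcOut j s V w) → ∃ t' < t, R.Does B F t' j (Action.vcbcIn s V)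
  /-- the verifiable message of a correct process that has output `V` makes every correct process
  to which it is handed output `V` -/
  verifiability : ∀ p ∈ correct, ∀ q ∈ correct, ∀ j s V w t t', t < t' →
    R.Occurs t p (Event.vcbcOut j s V w) → R.Does B F t' q (Action.vcbcProof j s w) →
    ∃ t'' w', R.Occurs t'' q (Event.vcbcOut j s V w')

/-- The safety properties of asynchronous binary agreement, for all instances `r`. -/
structure ABASafety (correct : Finset (Fin N)) (B : ℕ) (F : ℕ → Fin N) (R : Run N M W) :
    Prop where
  agreement : ∀ p ∈ correct, ∀ q ∈ correct, ∀ r k k' b b' t t',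
    R.Occurs t p (Event.abaOut r k b) → R.Occurs t' q (Event.abaOut r k' b') → b = b'
  /-- a decided value has been proposed by a correct process -/
  validity : ∀ p ∈ correct, ∀ r k b t, R.Occurs t p (Event.abaOut r k b) →
    ∃ q ∈ correct, ∃ t' < t, R.Does B F t' q (Action.abaIn r b)

/-- An execution of the protocol over VCBC and ABA; termination of ABA, which is probabilistic,
is stated separately. -/
structure IsExecution (correct : Finset (Fin N)) (B : ℕ) (F : ℕ → Fin N) (R : Run N M W) :
    Prop where
  follows : Follows correct B F R
  links : ReliableLinks correct B F R
  vcbc : VCBCSpec correct B F R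
  aba : ABASafety correct B F R

/-- Probabilistic termination of ABA: for each instance `r` and each correct process `p`, the
probability that all correct processes take part in the instance and that `p` is undecided after
`k` internal rounds tends to zero as `k` tends to infinity. -/
def ABATermination {Ω : Type*} [MeasurableSpace Ω] (μ : Measure Ω) (correct : Finset (Fin N))
    (B : ℕ) (F : ℕ → Fin N) (E : Ω → Run N M W) : Prop :=
  ∀ p ∈ correct, ∀ r : ℕ, Tendsto (fun k : ℕ => μ {ω |
    (∀ q ∈ correct, ∃ t b, (E ω).Does B F t q (Action.abaIn r b)) ∧
    ¬ ∃ t, ∃ k' ≤ k, ∃ b, (E ω).Occurs t p (Event.abaOut r k' b)}) atTop (𝓝 0)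

namespace Run

/-- Process `p` broadcasts `m`: it inputs a proposal that contains `m` to one of its VCBC
instances. -/
def Broadcasts (B : ℕ) (F : ℕ → Fin N) (R : Run N M W) (p : Fin N) (m : M) : Prop :=
  ∃ t s V, m ∈ V ∧ R.Does B F t p (Action.vcbcIn s V)

/-- Process `p` is given `m` by a client at some time, and the batch collected at that time is
eventually filled, which is automatic for batch size one. -/
def Submits (B : ℕ) (F : ℕ → Fin N) (R : Run N M W) (p : Fin N) (m : M) : Prop :=
  ∃ t, R.Occurs t p (Event.client m) ∧
    (B = 1 ∨ ∃ t' ≥ t, ∃ s V, R.Does B F t' p (Action.vcbcIn s V))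

/-- Process `p` eventually delivers `m`. -/
def Delivers (B : ℕ) (F : ℕ → Fin N) (R : Run N M W) (p : Fin N) (m : M) : Prop :=
  ∃ t, R.Does B F t p (Action.deliver m)

end Run

end Spec

end Alea

/-!
# Validity of Alea-BFT

Fix an execution in which every ABA instance with input from all correct processes terminates; by
`ABATermination.ae_terminates` almost every execution is such. Three facts carry the proof.

*Agreement.* At a correct process, a slot whose VCBC instance has output `V` is full with `V` as
long as the proposal `V` is undelivered and removed afterwards (`IsExecution.slot_eq`). Hence, by
consistency of VCBC, two correct processes that have delivered the same proposals and both have a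
value in the head slot of a queue have the same head and the same value there; if only one of them
has, the other is not ahead of it. By induction on the round, correct processes in the same
round have delivered the same proposals (`IsExecution.batches_agree`).

*Progress.* After decision `1` in a round, a correct process has proposed `1`, so its head slot was
full. Any other correct process is at most as far, and what it lacks are VCBC outputs, which it
obtains from the answer to its `FILL-GAP` request (`IsExecution.exists_vcbcOut_of_fillGap`). So
every correct process reaches every round (`IsExecution.exists_round_start`).

*Validity.* Let `p` input `V` to `VCBC (p, s)`, with `m ∈ V`. All slots up to `s` of the queue of
`p` are eventually used at all correct processes, because `p` numbers its proposals without gaps.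
As long as `m` is undelivered, slot `s` is not removed, so the head slot of this queue is full
everywhere, all correct processes propose `1` in its rounds, and each such round removes a head
slot. This can happen only finitely often before the head passes `s`
(`IsExecution.delivers_of_broadcasts`). A message that a client submits either has been delivered
already or ends up in the next proposal.
-/

namespace Alea

/-! ### Priority queues -/

namespace PQueue

variable {V : Type*}

theorem dequeue_apply_eq_empty_iff (Q : PQueue V) (v : V) (s : ℕ) :
    Q.dequeue v s = Slot.empty ↔ Q s = Slot.empty := by
  unfold dequeue
  split_ifs with h <;> simp [h]

theorem dequeue_apply_of_eq_removed {Q : PQueue V} (v : V) {s : ℕ} (h : Q s = Slot.removed) :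
    Q.dequeue v s = Slot.removed := by
  simp [dequeue, h]

theorem enqueue_apply_of_ne_empty {Q : PQueue V} (i : ℕ) (v : V) {s : ℕ} (h : Q s ≠ Slot.empty) :
    Q.enqueue i v s = Q s := by
  unfold enqueue
  split_ifs with hs
  · subst hs
    cases hQ : Q s <;> simp_all
  · rfl

theorem enqueue_apply_of_ne (Q : PQueue V) {i s : ℕ} (v : V) (h : s ≠ i) :
    Q.enqueue i v s = Q s := by
  simp [enqueue, h]

theorem enqueue_apply_self {Q : PQueue V} {i : ℕ} (v : V) (h : Q i = Slot.empty) :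
    Q.enqueue i v i = Slot.full v := by
  simp [enqueue, h]

theorem eq_removed_of_lt_head {Q : PQueue V} {s : ℕ} (h : s < Q.head) : Q s = Slot.removed := by
  by_contra hs
  exact absurd (Nat.sInf_le (s := {s | Q s ≠ Slot.removed}) hs) (not_le.mpr h)

/-- All but finitely many slots are empty. Without this, the head could be a removed slot, as
`sInf ∅ = 0`. -/
def Bounded (Q : PQueue V) : Prop := ∃ n, ∀ s ≥ n, Q s = Slot.empty

theorem Bounded.head_ne_removed {Q : PQueue V} (h : Q.Bounded) : Q Q.head ≠ Slot.removed := by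
  obtain ⟨n, hn⟩ := h
  exact Nat.sInf_mem (s := {s | Q s ≠ Slot.removed}) ⟨n, by simp [hn n le_rfl]⟩

theorem head_le_of_ne_removed {Q : PQueue V} {s : ℕ} (h : Q s ≠ Slot.removed) : Q.head ≤ s := by
  by_contra hs
  exact h (eq_removed_of_lt_head (not_le.mp hs))

theorem Bounded.lt_head {Q : PQueue V} (h : Q.Bounded) {n : ℕ}
    (hn : ∀ s ≤ n, Q s = Slot.removed) : n < Q.head := by
  by_contra hs
  exact h.head_ne_removed (hn _ (not_lt.mp hs))

theorem peek_eq_some_iff {Q : PQueue V} {v : V} : Q.peek = some v ↔ Q Q.head = Slot.full v := by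
  unfold peek
  cases h : Q Q.head <;> simp

theorem ne_empty_of_le_head {Q : PQueue V} {v : V} (h : Q.peek = some v) {s : ℕ}
    (hs : s ≤ Q.head) : Q s ≠ Slot.empty := by
  rcases hs.eq_or_lt with rfl | hs
  · simp [peek_eq_some_iff.mp h]
  · simp [eq_removed_of_lt_head hs]

theorem Bounded.peek_isSome_iff {Q : PQueue V} (h : Q.Bounded) :
    Q.peek.isSome ↔ Q Q.head ≠ Slot.empty := by
  have := h.head_ne_removed
  unfold peek
  cases h : Q Q.head <;> simp_all

theorem Bounded.dequeue {Q : PQueue V} (h : Q.Bounded) (v : V) : (Q.dequeue v).Bounded := by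
  obtain ⟨n, hn⟩ := h
  exact ⟨n, fun s hs => (dequeue_apply_eq_empty_iff Q v s).mpr (hn s hs)⟩

theorem Bounded.enqueue {Q : PQueue V} (h : Q.Bounded) (i : ℕ) (v : V) :
    (Q.enqueue i v).Bounded := by
  obtain ⟨n, hn⟩ := h
  refine ⟨max n (i + 1), fun s hs => ?_⟩
  rw [enqueue_apply_of_ne Q v (by omega)]
  exact hn s (by omega)

end PQueue

variable {N : ℕ} {M W : Type*} {B : ℕ} {F : ℕ → Fin N}

/-! ### The steps of a correct process -/

/-- The possible outcomes of scheduling the agreement loop. -/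
theorem onTick_cases (F : ℕ → Fin N) (σ : LState N M W) :
    (σ.phase = Phase.start ∧ onTick F σ = ({ σ with phase := Phase.waitABA },
        [Action.abaIn σ.round (σ.queues (F σ.round)).peek.isSome])) ∨
    (σ.phase = Phase.waitABA ∧ σ.decision σ.round = none ∧ onTick F σ = (σ, [])) ∨
    (σ.phase = Phase.waitABA ∧ σ.decision σ.round = some false ∧
      onTick F σ = ({ σ with round := σ.round + 1, phase := Phase.start }, [])) ∨
    (σ.phase = Phase.waitABA ∧ σ.decision σ.round = some true ∧
      onTick F σ = ({ σ with phase := Phase.waitValue },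
        match (σ.queues (F σ.round)).peek with
        | some _ => []
        | none => (List.finRange N).map (fun k =>
            Action.send k (Msg.fillGap (F σ.round) (σ.queues (F σ.round)).head)))) ∨
    (σ.phase = Phase.waitValue ∧ (σ.queues (F σ.round)).peek = none ∧ onTick F σ = (σ, [])) ∨
    (σ.phase = Phase.waitValue ∧ ∃ V, (σ.queues (F σ.round)).peek = some V ∧
      onTick F σ = ({ (acDeliver V σ).1 with round := σ.round + 1, phase := Phase.start },
        (acDeliver V σ).2)) := by
  rcases hp : σ.phase with _ | _ | _
  · simp [onTick, hp]
  · rcases hd : σ.decision σ.round with _ | _ | _ <;> simp [onTick, hp, hd]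
  · rcases hq : (σ.queues (F σ.round)).peek with _ | V <;> simp [onTick, hp, hq]

theorem step_abaIn {σ : LState N M W} {e : Event N M W} {r : ℕ} {b : Bool}
    (h : Action.abaIn r b ∈ (step B F σ e).2) :
    σ.phase = Phase.start ∧ σ.round = r ∧ (σ.queues (F r)).peek.isSome = b := by
  rcases e with m | ⟨j, s, V, w⟩ | ⟨r', k, b'⟩ | ⟨k, ⟨q, s⟩ | l⟩ | _
  · simp only [step, onClient] at h; split_ifs at h <;> simp at h
  · simp [step, onVCBC] at h
  · simp [step, onABA] at h
  · simp only [step, onFillGap] at h; split_ifs at h <;> simp at h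
  · simp [step, onFiller] at h
  · simp only [step] at h
    rcases onTick_cases F σ with ⟨hp, he⟩ | ⟨hp, hd, he⟩ | ⟨hp, hd, he⟩ | ⟨hp, hd, he⟩ |
      ⟨hp, hq, he⟩ | ⟨hp, V, hq, he⟩ <;> rw [he] at h
    · simp only [List.mem_singleton, Action.abaIn.injEq] at h
      obtain ⟨rfl, rfl⟩ := h
      exact ⟨hp, rfl, rfl⟩
    · simp at h
    · simp at h
    · cases hq : (σ.queues (F σ.round)).peek <;> simp [hq] at h
    · simp at h
    · simp [acDeliver] at h

open Classical in
theorem step_vcbcIn {σ : LState N M W} {e : Event N M W} {s : ℕ} {V : Finset M}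
    (h : Action.vcbcIn s V ∈ (step B F σ e).2) :
    ∃ m, e = Event.client m ∧ V = insert m σ.buf ∧ s = σ.priority := by
  rcases e with m | ⟨j, s, V, w⟩ | ⟨r', k, b'⟩ | ⟨k, ⟨q, s⟩ | l⟩ | _
  · simp only [step, onClient] at h; split_ifs at h <;> simp at h
    exact ⟨m, rfl, h.2, h.1⟩
  · simp [step, onVCBC] at h
  · simp [step, onABA] at h
  · simp only [step, onFillGap] at h; split_ifs at h <;> simp at h
  · simp [step, onFiller] at h
  · simp only [step] at h
    rcases onTick_cases F σ with ⟨hp, he⟩ | ⟨hp, hd, he⟩ | ⟨hp, hd, he⟩ | ⟨hp, hd, he⟩ |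
      ⟨hp, hq, he⟩ | ⟨hp, V, hq, he⟩ <;> rw [he] at h
    · simp at h
    · simp at h
    · simp at h
    · cases hq : (σ.queues (F σ.round)).peek <;> simp [hq] at h
    · simp at h
    · simp [acDeliver] at h

/-- Every step either leaves the queues, the delivered messages and proposals alone, or stores a
VCBC output, or delivers a proposal. -/
theorem step_queues_cases (σ : LState N M W) (e : Event N M W) :
    ((step B F σ e).1.queues = σ.queues ∧
      (step B F σ e).1.batches = σ.batches ∧ (step B F σ e).1.S = σ.S ∧
      (step B F σ e).1.proof = σ.proof) ∨
    (∃ j s V w, e = Event.vcbcOut j s V w) ∨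
    (∃ V, (step B F σ e).1.queues = (fun j => (σ.queues j).dequeue V) ∧
      (step B F σ e).1.batches = insert V σ.batches ∧
      (step B F σ e).1.S = σ.S ∪ {m | m ∈ V} ∧
      (step B F σ e).1.proof = σ.proof ∧
      ∀ m ∈ V, m ∉ σ.S → Action.deliver m ∈ (step B F σ e).2) := by
  rcases e with m | ⟨j, s, V, w⟩ | ⟨r', k, b'⟩ | ⟨k, ⟨q, s⟩ | l⟩ | _
  · left; simp only [step, onClient]; split_ifs <;> simp
  · right; left; exact ⟨_, _, _, _, rfl⟩
  · left; simp [step, onABA]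
  · left; simp only [step, onFillGap]; split_ifs <;> simp
  · left; simp [step, onFiller]
  · simp only [step]
    rcases onTick_cases F σ with ⟨hp, he⟩ | ⟨hp, hd, he⟩ | ⟨hp, hd, he⟩ | ⟨hp, hd, he⟩ |
      ⟨hp, hq, he⟩ | ⟨hp, V, hq, he⟩ <;> rw [he]
    · left; simp
    · left; simp
    · left; simp
    · left; simp
    · left; simp
    · right; right
      refine ⟨V, rfl, rfl, rfl, rfl, fun m hm hS => ?_⟩
      simp [acDeliver, hm, hS]

/-- Every step either keeps the round and the delivered proposals, or ends the round. -/
theorem step_round_cases (σ : LState N M W) (e : Event N M W) :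
    ((step B F σ e).1.round = σ.round ∧ (step B F σ e).1.batches = σ.batches) ∨
    ((step B F σ e).1.round = σ.round + 1 ∧
      ((σ.decision σ.round = some false ∧
          (step B F σ e).1.batches = σ.batches) ∨
        (σ.phase = Phase.waitValue ∧ ∃ V, (σ.queues (F σ.round)).peek = some V ∧
          (step B F σ e).1.batches = insert V σ.batches ∧
          (step B F σ e).1.queues = (fun j => (σ.queues j).dequeue V)))) := by
  rcases e with m | ⟨j, s, V, w⟩ | ⟨r', k, b'⟩ | ⟨k, ⟨q, s⟩ | l⟩ | _
  · left; simp only [step, onClient]; split_ifs <;> simp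
  · left; simp [step, onVCBC]
  · left; simp [step, onABA]
  · left; simp only [step, onFillGap]; split_ifs <;> simp
  · left; simp [step, onFiller]
  · simp only [step]
    rcases onTick_cases F σ with ⟨hp, he⟩ | ⟨hp, hd, he⟩ | ⟨hp, hd, he⟩ | ⟨hp, hd, he⟩ |
      ⟨hp, hq, he⟩ | ⟨hp, V, hq, he⟩ <;> rw [he]
    · left; simp
    · left; simp
    · right; simp [hp, hd]
    · left; simp
    · left; simp
    · right
      exact ⟨rfl, Or.inr ⟨hp, V, hq, rfl, rfl⟩⟩

/-- Only the agreement loop changes the round and the phase. -/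
theorem step_of_ne_tick (σ : LState N M W) {e : Event N M W} (he : e ≠ Event.tick) :
    (step B F σ e).1.round = σ.round ∧ (step B F σ e).1.phase = σ.phase := by
  rcases e with m | ⟨j, s, V, w⟩ | ⟨r', k, b'⟩ | ⟨k, ⟨q, s⟩ | l⟩ | _
  · simp only [step, onClient]; split_ifs <;> simp
  · simp [step, onVCBC]
  · simp [step, onABA]
  · simp only [step, onFillGap]; split_ifs <;> simp
  · simp [step, onFiller]
  · exact absurd rfl he

/-- Only a decision of ABA changes the record of decisions. -/
theorem step_decision (σ : LState N M W) {e : Event N M W}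
    (he : ∀ r k b, e ≠ Event.abaOut r k b) : (step B F σ e).1.decision = σ.decision := by
  rcases e with m | ⟨j, s, V, w⟩ | ⟨r', k, b'⟩ | ⟨k, ⟨q, s⟩ | l⟩ | _
  · simp only [step, onClient]; split_ifs <;> simp
  · simp [step, onVCBC]
  · exact absurd rfl (he _ _ _)
  · simp only [step, onFillGap]; split_ifs <;> simp
  · simp [step, onFiller]
  · simp only [step]
    rcases onTick_cases F σ with ⟨hp, he⟩ | ⟨hp, hd, he⟩ | ⟨hp, hd, he⟩ | ⟨hp, hd, he⟩ |
      ⟨hp, hq, he⟩ | ⟨hp, V, hq, he⟩ <;> rw [he]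
    rfl

/-- Only client messages change the buffer and the counter of own proposals. -/
theorem step_of_ne_client (σ : LState N M W) {e : Event N M W}
    (he : ∀ m, e ≠ Event.client m) :
    (step B F σ e).1.buf = σ.buf ∧ (step B F σ e).1.priority = σ.priority := by
  rcases e with m | ⟨j, s, V, w⟩ | ⟨r', k, b'⟩ | ⟨k, ⟨q, s⟩ | l⟩ | _
  · exact absurd rfl (he _)
  · simp [step, onVCBC]
  · simp [step, onABA]
  · simp only [step, onFillGap]; split_ifs <;> simp
  · simp [step, onFiller]
  · simp only [step]
    rcases onTick_cases F σ with ⟨hp, he⟩ | ⟨hp, hd, he⟩ | ⟨hp, hd, he⟩ | ⟨hp, hd, he⟩ |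
      ⟨hp, hq, he⟩ | ⟨hp, V, hq, he⟩ <;> rw [he]
    all_goals simp [acDeliver]

variable {correct : Finset (Fin N)} {R : Run N M W} {p : Fin N}

/-! ### Invariants of a single correct process -/

namespace Follows

/-- To prove an invariant of a correct process, it suffices to consider its own steps. -/
theorem invariant (h : Follows correct B F R) (hp : p ∈ correct) {I : ℕ → LState N M W → Prop}
    (h0 : I 0 (LState.initial N M W))
    (hidle : ∀ t, R.proc t ≠ p → I t (R.state t p) → I (t + 1) (R.state t p))
    (hstep : ∀ t, R.proc t = p → I t (R.state t p) →
      I (t + 1) (step B F (R.state t p) (R.event t)).1) (t : ℕ) : I t (R.state t p) := by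
  induction t with
  | zero => rw [h.start p hp]; exact h0
  | succ t ih =>
    by_cases ht : R.proc t = p
    · rw [h.next p hp t ht]; exact hstep t ht ih
    · rw [h.idle p hp t ht]; exact hidle t ht ih

/-- A relation between consecutive states extends to all later states. -/
theorem relation (h : Follows correct B F R) (hp : p ∈ correct)
    {rel : LState N M W → LState N M W → Prop} (hrefl : ∀ σ, rel σ σ)
    (htrans : ∀ σ τ υ, rel σ τ → rel τ υ → rel σ υ)
    (hstep : ∀ σ e, rel σ (step B F σ e).1) {t t' : ℕ} (htt : t ≤ t') :
    rel (R.state t p) (R.state t' p) := by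
  induction t', htt using Nat.le_induction with
  | base => exact hrefl _
  | succ t' _ ih =>
    by_cases ht : R.proc t' = p
    · rw [h.next p hp t' ht]; exact htrans _ _ _ ih (hstep _ _)
    · rw [h.idle p hp t' ht]; exact ih

theorem removed_mono (h : Follows correct B F R) (hp : p ∈ correct) {t t' : ℕ} (htt : t ≤ t')
    {j : Fin N} {s : ℕ} :
    (R.state t p).queues j s = Slot.removed → (R.state t' p).queues j s = Slot.removed := by
  refine h.relation hp (rel := fun σ τ => σ.queues j s = Slot.removed →
    τ.queues j s = Slot.removed) (fun _ => id) (fun _ _ _ h1 h2 => h2 ∘ h1) ?_ htt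
  intro σ e hr
  rcases step_queues_cases (B := B) (F := F) σ e with ⟨hq, -⟩ | ⟨i, n, V, w, rfl⟩ |
    ⟨V, hq, -⟩
  · rw [hq, hr]
  · by_cases hj : j = i
    · subst hj
      have : (σ.queues j).enqueue n V s = Slot.removed := by
        rw [PQueue.enqueue_apply_of_ne_empty n V (by simp [hr]), hr]
      simp only [step, onVCBC, Function.update_self]
      split_ifs
      · exact PQueue.dequeue_apply_of_eq_removed V this
      · exact this
    · simpa [step, onVCBC, hj] using hr
  · rw [hq]
    exact PQueue.dequeue_apply_of_eq_removed V hr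

theorem bounded (h : Follows correct B F R) (hp : p ∈ correct) (t : ℕ) (j : Fin N) :
    ((R.state t p).queues j).Bounded := by
  refine h.invariant hp (I := fun _ σ => (σ.queues j).Bounded) ⟨0, fun _ _ => rfl⟩
    (fun _ _ => id) ?_ t
  intro t _ hb
  rcases step_queues_cases (B := B) (F := F) (R.state t p) (R.event t) with
    ⟨hq, -⟩ | ⟨i, n, V, w, he⟩ | ⟨V, hq, -⟩
  · rwa [hq]
  · rw [he]
    by_cases hj : j = i
    · subst hj
      simp only [step, onVCBC, Function.update_self]
      split_ifs
      · exact (hb.enqueue n V).dequeue V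
      · exact hb.enqueue n V
    · simpa [step, onVCBC, hj] using hb
  · rw [hq]
    exact hb.dequeue V

theorem head_mono (h : Follows correct B F R) (hp : p ∈ correct) {t t' : ℕ} (htt : t ≤ t')
    (j : Fin N) : ((R.state t p).queues j).head ≤ ((R.state t' p).queues j).head := by
  by_contra hlt
  exact (h.bounded hp t' j).head_ne_removed
    (h.removed_mono hp htt (PQueue.eq_removed_of_lt_head (not_le.mp hlt)))

theorem delivers_of_mem_S (h : Follows correct B F R) (hp : p ∈ correct) {t : ℕ} {m : M} :
    m ∈ (R.state t p).S → R.Delivers B F p m := by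
  refine h.invariant hp (I := fun _ σ => m ∈ σ.S → R.Delivers B F p m)
    (fun hm => absurd hm (Set.notMem_empty m)) (fun _ _ => id) ?_ t
  intro t ht ih hm
  by_cases hS : m ∈ (R.state t p).S
  · exact ih hS
  rcases step_queues_cases (B := B) (F := F) (R.state t p) (R.event t) with
    ⟨-, -, hq, -⟩ | ⟨i, n, V, w, he⟩ | ⟨V, -, -, hq, -, hd⟩
  · exact absurd (hq ▸ hm) hS
  · rw [he] at hm
    exact absurd hm hS
  · rw [hq] at hm
    exact ⟨t, ht, hd m (hm.resolve_left hS) hS⟩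

theorem delivers_of_mem_batches (h : Follows correct B F R) (hp : p ∈ correct) {t : ℕ}
    {V : Finset M} (hV : V ∈ (R.state t p).batches) {m : M} (hm : m ∈ V) :
    R.Delivers B F p m := by
  refine h.delivers_of_mem_S hp (t := t) ?_
  refine h.invariant hp (I := fun _ σ => V ∈ σ.batches → m ∈ σ.S)
    (fun hm => absurd hm (Set.notMem_empty V)) (fun _ _ => id) ?_ t hV
  intro t ht ih hV
  rcases step_queues_cases (B := B) (F := F) (R.state t p) (R.event t) with
    ⟨-, hb, hq, -⟩ | ⟨i, n, V, w, he⟩ | ⟨V', -, hb, hq, -⟩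
  · rw [hq]; exact ih (hb ▸ hV)
  · rw [he] at hV ⊢
    exact ih hV
  · rw [hq]
    rw [hb] at hV
    rcases hV with rfl | hV
    · exact Or.inr hm
    · exact Or.inl (ih hV)

theorem round_mono (h : Follows correct B F R) (hp : p ∈ correct) {t t' : ℕ} (htt : t ≤ t') :
    (R.state t p).round ≤ (R.state t' p).round := by
  refine h.relation hp (rel := fun σ τ => σ.round ≤ τ.round) (fun _ => le_rfl)
    (fun _ _ _ => le_trans) ?_ htt
  intro σ e
  rcases step_round_cases (B := B) (F := F) σ e with ⟨hr, -⟩ | ⟨hr, -⟩ <;> omega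

theorem batches_eq_of_round_eq (h : Follows correct B F R) (hp : p ∈ correct) {t t' : ℕ}
    (hr : (R.state t p).round = (R.state t' p).round) :
    (R.state t p).batches = (R.state t' p).batches := by
  wlog htt : t ≤ t' generalizing t t'
  · exact (this hr.symm (le_of_not_ge htt)).symm
  refine (h.relation hp (rel := fun σ τ => σ.round ≤ τ.round ∧
    (σ.round = τ.round → σ.batches = τ.batches)) (fun _ => ⟨le_rfl, fun _ => rfl⟩)
    ?_ ?_ htt).2 hr
  · rintro σ τ υ ⟨h1, h2⟩ ⟨h3, h4⟩
    refine ⟨h1.trans h3, fun he => ?_⟩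
    rw [h2 (by omega), h4 (by omega)]
  · intro σ e
    rcases step_round_cases (B := B) (F := F) σ e with ⟨hr, hb⟩ | ⟨hr, -⟩
    · exact ⟨hr.ge, fun _ => hb.symm⟩
    · exact ⟨by omega, fun _ => by omega⟩

/-- A correct process that has reached round `r + 1` has ended round `r`, either on decision `0`
or by delivering a proposal. -/
theorem exists_round_end (h : Follows correct B F R) (hp : p ∈ correct) {t r : ℕ}
    (hr : (R.state t p).round = r + 1) :
    ∃ t' < t, (R.state t' p).round = r ∧
      (((R.state t' p).decision r = some false ∧
          (R.state t p).batches = (R.state t' p).batches) ∨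
        ((R.state t' p).phase = Phase.waitValue ∧
          ∃ V, ((R.state t' p).queues (F r)).peek = some V ∧
          (R.state t p).batches = insert V (R.state t' p).batches ∧
          (R.state (t' + 1) p).queues = fun j => ((R.state t' p).queues j).dequeue V)) := by
  induction t with
  | zero => rw [h.start p hp] at hr; simp [LState.initial] at hr
  | succ t ih =>
    by_cases hrt : (R.state t p).round = r + 1
    · obtain ⟨t', htt, h'⟩ := ih hrt
      rw [h.batches_eq_of_round_eq hp (hr.trans hrt.symm)]
      exact ⟨t', by omega, h'⟩
    · by_cases ht : R.proc t = p
      · have hn := h.next p hp t ht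
        rcases step_round_cases (B := B) (F := F) (R.state t p) (R.event t) with
          ⟨hr', -⟩ | ⟨hr', hc⟩
        · rw [hn, hr'] at hr; exact absurd hr hrt
        · rw [hn, hr'] at hr
          have hr0 : (R.state t p).round = r := by omega
          rw [hr0] at hc
          refine ⟨t, by omega, hr0, ?_⟩
          rw [hn]
          rcases hc with ⟨hd, hb⟩ | ⟨hph, V, hV, hb, hq⟩
          · exact Or.inl ⟨hd, hb⟩
          · exact Or.inr ⟨hph, V, hV, hb, hq⟩
      · rw [h.idle p hp t ht] at hr; exact absurd hr hrt

/-- The agreement loop is eventually scheduled again, and the first time this happens it is still at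
the same control point, because no other event moves it. -/
theorem exists_tick (h : Follows correct B F R) (hp : p ∈ correct) (t : ℕ) :
    ∃ t' ≥ t, R.Occurs t' p Event.tick ∧ (R.state t' p).round = (R.state t p).round ∧
      (R.state t' p).phase = (R.state t p).phase := by
  classical
  have hex := h.fair p hp t
  let t₁ := Nat.find hex
  obtain ⟨ht₁, hocc⟩ : t₁ ≥ t ∧ R.Occurs t₁ p Event.tick := Nat.find_spec hex
  refine ⟨t₁, ht₁, hocc, ?_⟩
  suffices ∀ t' ≥ t, t' ≤ t₁ → (R.state t' p).round = (R.state t p).round ∧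
    (R.state t' p).phase = (R.state t p).phase from this t₁ ht₁ le_rfl
  intro t' htt
  induction t', htt using Nat.le_induction with
  | base => intro _; exact ⟨rfl, rfl⟩
  | succ t' ht' ih =>
    intro hle
    obtain ⟨h1, h2⟩ := ih (by omega)
    have hno : ¬ R.Occurs t' p Event.tick := fun hc =>
      Nat.find_min hex (m := t') (by omega) ⟨ht', hc⟩
    by_cases hpr : R.proc t' = p
    · obtain ⟨h3, h4⟩ := step_of_ne_tick (B := B) (F := F) (R.state t' p) (e := R.event t')
        (fun he => hno ⟨hpr, he⟩)
      rw [h.next p hp t' hpr, h3, h4]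
      exact ⟨h1, h2⟩
    · rw [h.idle p hp t' hpr]
      exact ⟨h1, h2⟩

/-- A correct process inputs its proposals to its VCBC instances without gaps. -/
theorem exists_vcbcIn_of_lt_priority (h : Follows correct B F R) (hp : p ∈ correct) {t s : ℕ} :
    s < (R.state t p).priority → ∃ t' V, R.Does B F t' p (Action.vcbcIn s V) := by
  refine h.invariant hp (I := fun _ σ => s < σ.priority →
    ∃ t' V, R.Does B F t' p (Action.vcbcIn s V))
    (fun hs => absurd hs (Nat.not_lt_zero s)) (fun _ _ => id) ?_ t
  intro t ht ih hs
  by_cases hc : ∃ m, R.event t = Event.client m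
  · obtain ⟨m, he⟩ := hc
    by_cases hs' : s < (R.state t p).priority
    · exact ih hs'
    rw [he] at hs
    simp only [step, onClient] at hs
    split_ifs at hs with h1 h2
    · exact absurd hs hs'
    · simp only at hs
      obtain rfl : s = (R.state t p).priority := by omega
      classical
      refine ⟨t, insert m (R.state t p).buf, ht, ?_⟩
      rw [he]
      simp only [step, onClient, h1, if_false]
      rw [if_pos (by convert h2)]
      simp
    · exact absurd hs hs'
  · rw [(step_of_ne_client (B := B) (F := F) (R.state t p) (not_exists.mp hc)).2] at hs
    exact ih hs

/-- In particular the buffer is always empty for batch size one. -/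
theorem card_buf_lt (h : Follows correct B F R) (hp : p ∈ correct) (hB : 0 < B) (t : ℕ) :
    (R.state t p).buf.card < B := by
  refine h.invariant hp (I := fun _ σ => σ.buf.card < B) (by simpa [LState.initial] using hB)
    (fun _ _ => id) ?_ t
  intro t _ ih
  by_cases hc : ∃ m, R.event t = Event.client m
  · obtain ⟨m, he⟩ := hc
    rw [he]
    simp only [step, onClient]
    split_ifs with h1 h2
    · exact ih
    · simpa using hB
    · classical
      have h3 := Finset.card_insert_le m (R.state t p).buf
      refine lt_of_le_of_ne (le_trans ?_ ih) h2
      convert h3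
  · rw [(step_of_ne_client (B := B) (F := F) (R.state t p) (not_exists.mp hc)).1]
    exact ih

/-- The next proposal that a correct process inputs contains its present buffer. -/
theorem broadcasts_of_mem_buf (h : Follows correct B F R) (hp : p ∈ correct) {t t' : ℕ} {m : M}
    (hm : m ∈ (R.state t p).buf) (htt : t ≤ t') {s : ℕ} {V : Finset M}
    (hV : R.Does B F t' p (Action.vcbcIn s V)) : R.Broadcasts B F p m := by
  classical
  induction htt using Nat.decreasingInduction with
  | self =>
    obtain ⟨m', -, rfl, -⟩ := step_vcbcIn hV.2
    exact ⟨t', s, _, by simp [hm], hV⟩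
  | of_succ t _ ih =>
    by_cases hd : ∃ s V, R.Does B F t p (Action.vcbcIn s V)
    · obtain ⟨s, V, hd⟩ := hd
      obtain ⟨m', -, rfl, -⟩ := step_vcbcIn hd.2
      exact ⟨t, s, _, by simp [hm], hd⟩
    refine ih ?_
    by_cases hpr : R.proc t = p
    · rw [h.next p hp t hpr]
      by_cases hc : ∃ m, R.event t = Event.client m
      · obtain ⟨m', he⟩ := hc
        rw [he]
        simp only [step, onClient]
        split_ifs with h1 h2
        · exact hm
        · refine absurd ⟨(R.state t p).priority, insert m' (R.state t p).buf, hpr, ?_⟩ hd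
          rw [he]
          simp only [step, onClient, h1, if_false]
          rw [if_pos (by convert h2)]
          simp
        · simp [hm]
      · rwa [(step_of_ne_client (B := B) (F := F) (R.state t p) (not_exists.mp hc)).1]
    · rwa [h.idle p hp t hpr]

theorem broadcasts_or_delivers_of_submits (h : Follows correct B F R) (hp : p ∈ correct) {m : M}
    (hm : R.Submits B F p m) : R.Broadcasts B F p m ∨ R.Delivers B F p m := by
  classical
  obtain ⟨t, ⟨hpr, he⟩, hfill⟩ := hm
  by_cases hS : m ∈ (R.state t p).S
  · exact Or.inr (h.delivers_of_mem_S hp hS)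
  left
  have hstep : step B F (R.state t p) (R.event t) = onClient B m (R.state t p) := by rw [he]; rfl
  by_cases hB : (insert m (R.state t p).buf).card = B
  · refine ⟨t, (R.state t p).priority, insert m (R.state t p).buf,
      Finset.mem_insert_self _ _, hpr, ?_⟩
    rw [hstep]
    simp only [onClient, hS, if_false]
    rw [if_pos (by convert hB)]
    simp
  have hnext : (R.state (t + 1) p).buf = insert m (R.state t p).buf ∧
      (step B F (R.state t p) (R.event t)).2 = [] := by
    rw [h.next p hp t hpr, hstep]
    simp only [onClient, hS, if_false]
    rw [if_neg (by convert hB)]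
    exact ⟨by ext; simp, rfl⟩
  rcases hfill with rfl | ⟨t', htt, s, V, hV⟩
  · have h1 := h.card_buf_lt hp Nat.one_pos t
    obtain h2 : (R.state t p).buf = ∅ := by simpa using h1
    simp [h2] at hB
  · rcases htt.eq_or_lt with rfl | hlt
    · have h2 := hV.2
      rw [hnext.2] at h2
      simp at h2
    · exact h.broadcasts_of_mem_buf hp (t := t + 1) (by simp [hnext.1]) hlt hV

end Follows

/-! ### Invariants that depend on VCBC and ABA -/

namespace IsExecution

/-- A used slot comes from a VCBC output. -/
theorem exists_vcbcOut (h : IsExecution correct B F R) (hp : p ∈ correct) {t s : ℕ} {j : Fin N} :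
    (R.state t p).queues j s ≠ Slot.empty →
      ∃ t' < t, ∃ V w, R.Occurs t' p (Event.vcbcOut j s V w) := by
  refine h.follows.invariant hp (I := fun t σ => σ.queues j s ≠ Slot.empty →
    ∃ t' < t, ∃ V w, R.Occurs t' p (Event.vcbcOut j s V w)) (fun hs => absurd rfl hs) ?_ ?_ t
  · intro t _ ih hs
    obtain ⟨t', ht', hx⟩ := ih hs
    exact ⟨t', by omega, hx⟩
  · intro t ht ih hs
    by_cases he : ∃ V w, R.event t = Event.vcbcOut j s V w
    · obtain ⟨V, w, he⟩ := he
      exact ⟨t, by omega, V, w, ht, he⟩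
    suffices (R.state t p).queues j s ≠ Slot.empty by
      obtain ⟨t', ht', hx⟩ := ih this
      exact ⟨t', by omega, hx⟩
    rcases step_queues_cases (B := B) (F := F) (R.state t p) (R.event t) with
      ⟨hq, -⟩ | ⟨i, n, V, w, he'⟩ | ⟨V, hq, -⟩
    · rwa [hq] at hs
    · rw [he'] at hs
      by_cases hj : j = i
      · subst hj
        have hne : s ≠ n := by rintro rfl; exact he ⟨V, w, he'⟩
        simp only [step, onVCBC, Function.update_self] at hs
        split_ifs at hs
        · rwa [ne_eq, PQueue.dequeue_apply_eq_empty_iff, PQueue.enqueue_apply_of_ne _ _ hne] at hs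
        · rwa [PQueue.enqueue_apply_of_ne _ _ hne] at hs
      · simpa [step, onVCBC, hj] using hs
    · rw [hq] at hs
      rwa [ne_eq, PQueue.dequeue_apply_eq_empty_iff] at hs

open Classical in
/-- The slot of an instance that has output `V` contains `V` until the proposal `V` is delivered,
and is removed from then on. -/
theorem slot_eq (h : IsExecution correct B F R) (hp : p ∈ correct) {t₀ s : ℕ} {j : Fin N}
    {V : Finset M} {w : W} (hV : R.Occurs t₀ p (Event.vcbcOut j s V w)) {t : ℕ} (ht : t₀ < t) :
    (R.state t p).queues j s =
      if V ∈ (R.state t p).batches then Slot.removed else Slot.full V := by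
  induction t, ht using Nat.le_induction with
  | base =>
    have hempty : (R.state t₀ p).queues j s = Slot.empty := by
      by_contra hne
      obtain ⟨t', ht', V', w', hV'⟩ := h.exists_vcbcOut hp hne
      exact absurd (h.vcbc.integrity p hp j s V' V w' w t' t₀ hV' hV) (by omega)
    rw [Nat.succ_eq_add_one, h.follows.next p hp t₀ hV.1, hV.2]
    simp only [step, onVCBC, Function.update_self]
    split_ifs
    · simp [PQueue.dequeue, PQueue.enqueue_apply_self V hempty, *]
    · simp [PQueue.enqueue_apply_self V hempty, *]
  | succ t hlt ih =>
    by_cases hpr : R.proc t = p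
    · rw [h.follows.next p hp t hpr]
      rcases step_queues_cases (B := B) (F := F) (R.state t p) (R.event t) with
        ⟨hq, hb, -⟩ | ⟨i, n, V', w', he'⟩ | ⟨V', hq, hb, -⟩
      · rw [hq, hb, ih]
      · rw [he']
        have hb : (step B F (R.state t p) (Event.vcbcOut i n V' w')).1.batches =
          (R.state t p).batches := rfl
        rw [hb]
        by_cases hj : j = i
        · subst hj
          have hne : s ≠ n := by
            rintro rfl
            have := h.vcbc.integrity p hp j s V V' w w' t₀ t hV ⟨hpr, he'⟩
            omega
          simp only [step, onVCBC, Function.update_self]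
          split_ifs with h1 h2 h2 <;>
            simp [PQueue.dequeue, PQueue.enqueue_apply_of_ne _ _ hne, ih, h2]
          rintro rfl
          exact h2 h1
        · simpa [step, onVCBC, hj] using ih
      · rw [hq, hb]
        by_cases h1 : V ∈ (R.state t p).batches
        · simp [PQueue.dequeue, ih, h1]
        · by_cases h2 : V = V' <;> simp [PQueue.dequeue, ih, h1, h2]
    · rw [h.follows.idle p hp t hpr, ih]

theorem slot_ne_empty (h : IsExecution correct B F R) (hp : p ∈ correct) {t₀ s : ℕ} {j : Fin N}
    {V : Finset M} {w : W} (hV : R.Occurs t₀ p (Event.vcbcOut j s V w)) {t : ℕ} (ht : t₀ < t) :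
    (R.state t p).queues j s ≠ Slot.empty := by
  classical
  rw [h.slot_eq hp hV ht]
  split_ifs <;> simp

theorem exists_vcbcOut_of_full (h : IsExecution correct B F R) (hp : p ∈ correct) {t s : ℕ}
    {j : Fin N} {V : Finset M} (hs : (R.state t p).queues j s = Slot.full V) :
    V ∉ (R.state t p).batches ∧ ∃ t' < t, ∃ w, R.Occurs t' p (Event.vcbcOut j s V w) := by
  classical
  obtain ⟨t', ht', V', w, hV'⟩ := h.exists_vcbcOut hp (t := t) (s := s) (j := j) (by simp [hs])
  have := h.slot_eq hp hV' ht'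
  rw [hs] at this
  split_ifs at this with hb
  obtain rfl : V = V' := by simpa using this
  exact ⟨hb, t', ht', w, hV'⟩

theorem exists_vcbcOut_of_removed (h : IsExecution correct B F R) (hp : p ∈ correct) {t s : ℕ}
    {j : Fin N} (hs : (R.state t p).queues j s = Slot.removed) :
    ∃ V ∈ (R.state t p).batches, ∃ t' < t, ∃ w, R.Occurs t' p (Event.vcbcOut j s V w) := by
  classical
  obtain ⟨t', ht', V, w, hV⟩ := h.exists_vcbcOut hp (t := t) (s := s) (j := j) (by simp [hs])
  have := h.slot_eq hp hV ht'
  rw [hs] at this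
  split_ifs at this with hb
  exact ⟨V, hb, t', ht', w, hV⟩

/-- The stored verifiable messages are those of the outputs that have occurred. -/
theorem proof_eq_some_iff (h : IsExecution correct B F R) (hp : p ∈ correct) {t s : ℕ} {j : Fin N}
    {w : W} : (R.state t p).proof j s = some w ↔
      ∃ t' < t, ∃ V, R.Occurs t' p (Event.vcbcOut j s V w) := by
  refine h.follows.invariant hp (I := fun t σ => σ.proof j s = some w ↔
    ∃ t' < t, ∃ V, R.Occurs t' p (Event.vcbcOut j s V w)) ?_ ?_ ?_ t
  · simp [LState.initial]
  · intro t ht ih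
    rw [ih]
    constructor
    · rintro ⟨t', ht', hx⟩
      exact ⟨t', by omega, hx⟩
    · rintro ⟨t', ht', V, hV⟩
      have : t' ≠ t := by rintro rfl; exact ht hV.1
      exact ⟨t', by omega, V, hV⟩
  · intro t ht ih
    by_cases he : ∃ V w', R.event t = Event.vcbcOut j s V w'
    · obtain ⟨V, w', he⟩ := he
      rw [he]
      simp only [step, onVCBC, Function.update_self, Option.some.injEq]
      constructor
      · rintro rfl
        exact ⟨t, by omega, V, ht, he⟩
      · rintro ⟨t', ht', V', hV'⟩
        obtain rfl := h.vcbc.integrity p hp j s V' V w w' t' t hV' ⟨ht, he⟩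
        have := hV'.2
        rw [he] at this
        simp only [Event.vcbcOut.injEq] at this
        tauto
    · have hpf : (step B F (R.state t p) (R.event t)).1.proof j s = (R.state t p).proof j s := by
        rcases step_queues_cases (B := B) (F := F) (R.state t p) (R.event t) with
          ⟨-, -, -, hq⟩ | ⟨i, n, V', w', he'⟩ | ⟨V', -, -, -, hq, -⟩
        · rw [hq]
        · rw [he']
          by_cases hj : j = i
          · subst hj
            have hne : s ≠ n := by rintro rfl; exact he ⟨V', w', he'⟩
            simp [step, onVCBC, hne]
          · simp [step, onVCBC, hj]
        · rw [hq]
      rw [hpf, ih]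
      constructor
      · rintro ⟨t', ht', hx⟩
        exact ⟨t', by omega, hx⟩
      · rintro ⟨t', ht', V, hV⟩
        have : t' ≠ t := by rintro rfl; exact he ⟨V, w, hV.2⟩
        exact ⟨t', by omega, V, hV⟩

/-- The recorded decisions are those that have occurred. -/
theorem decision_eq_some_iff (h : IsExecution correct B F R) (hp : p ∈ correct) {t r : ℕ}
    {b : Bool} : (R.state t p).decision r = some b ↔
      ∃ t' < t, ∃ k, R.Occurs t' p (Event.abaOut r k b) := by
  refine h.follows.invariant hp (I := fun t σ => σ.decision r = some b ↔
    ∃ t' < t, ∃ k, R.Occurs t' p (Event.abaOut r k b)) ?_ ?_ ?_ t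
  · simp [LState.initial]
  · intro t ht ih
    rw [ih]
    constructor
    · rintro ⟨t', ht', hx⟩
      exact ⟨t', by omega, hx⟩
    · rintro ⟨t', ht', k, hk⟩
      have : t' ≠ t := by rintro rfl; exact ht hk.1
      exact ⟨t', by omega, k, hk⟩
  · intro t ht ih
    by_cases he : ∃ k b', R.event t = Event.abaOut r k b'
    · obtain ⟨k, b', he⟩ := he
      rw [he]
      simp only [step, onABA, Function.update_self, Option.some.injEq]
      constructor
      · rintro rfl
        exact ⟨t, by omega, k, ht, he⟩
      · rintro ⟨t', ht', k', hk'⟩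
        exact (h.aba.agreement p hp p hp r k' k b b' t' t hk' ⟨ht, he⟩).symm
    · have hpf : (step B F (R.state t p) (R.event t)).1.decision r =
          (R.state t p).decision r := by
        by_cases he' : ∃ r' k b', R.event t = Event.abaOut r' k b'
        · obtain ⟨r', k, b', he'⟩ := he'
          have hne : r ≠ r' := by rintro rfl; exact he ⟨k, b', he'⟩
          rw [he']
          simp [step, onABA, hne]
        · push Not at he'
          rw [step_decision _ he']
      rw [hpf, ih]
      constructor
      · rintro ⟨t', ht', hx⟩
        exact ⟨t', by omega, hx⟩
      · rintro ⟨t', ht', k, hk⟩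
        have : t' ≠ t := by rintro rfl; exact he ⟨k, b, hk.2⟩
        exact ⟨t', by omega, k, hk⟩

theorem decision_mono (h : IsExecution correct B F R) (hp : p ∈ correct) {t t' r : ℕ} {b : Bool}
    (htt : t ≤ t') (hd : (R.state t p).decision r = some b) :
    (R.state t' p).decision r = some b := by
  rw [h.decision_eq_some_iff hp] at hd ⊢
  obtain ⟨t₀, ht₀, hx⟩ := hd
  exact ⟨t₀, by omega, hx⟩

theorem decision_eq_true_of_waitValue (h : IsExecution correct B F R) (hp : p ∈ correct) (t : ℕ) :
    (R.state t p).phase = Phase.waitValue →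
      (R.state t p).decision (R.state t p).round = some true := by
  induction t with
  | zero => rw [h.follows.start p hp]; simp [LState.initial]
  | succ t ih =>
    intro hph
    suffices (R.state t p).decision (R.state t p).round = some true ∧
        (R.state (t + 1) p).round = (R.state t p).round by
      rw [this.2]
      exact h.decision_mono hp (Nat.le_succ t) this.1
    by_cases hpr : R.proc t = p
    · have hn := h.follows.next p hp t hpr
      by_cases he : R.event t = Event.tick
      · rw [he] at hn
        simp only [step] at hn
        rcases onTick_cases F (R.state t p) with ⟨hp, he⟩ | ⟨hp, hd, he⟩ | ⟨hp, hd, he⟩ |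
          ⟨hp, hd, he⟩ | ⟨hp, hq, he⟩ | ⟨hp, V, hq, he⟩ <;> rw [he] at hn <;>
          rw [hn] at hph ⊢ <;> simp_all
      · obtain ⟨h1, h2⟩ := step_of_ne_tick (B := B) (F := F) (R.state t p) he
        rw [hn] at hph ⊢
        rw [h1]
        exact ⟨ih (h2 ▸ hph), rfl⟩
    · rw [h.follows.idle p hp t hpr] at hph ⊢
      exact ⟨ih hph, rfl⟩

/-- If a correct process has recorded the decision `b` for round `r`, then a correct process has
proposed it before, in its own round `r`. -/
theorem exists_proposer (h : IsExecution correct B F R) (hp : p ∈ correct) {t r : ℕ} {b : Bool}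
    (hd : (R.state t p).decision r = some b) :
    ∃ u ∈ correct, ∃ t' < t, (R.state t' u).round = r ∧
      ((R.state t' u).queues (F r)).peek.isSome = b := by
  obtain ⟨t₁, ht₁, k, hk⟩ := (h.decision_eq_some_iff hp).mp hd
  obtain ⟨u, hu, t', ht', hdo⟩ := h.aba.validity p hp r k b t₁ hk
  obtain ⟨-, hr, hb⟩ := step_abaIn hdo.2
  exact ⟨u, hu, t', by omega, hr, hb⟩

/-! ### Agreement between correct processes -/

section Compare

variable {u : Fin N} {t t' : ℕ} {j : Fin N} {X : Finset M}

/-- If a correct process has a value in its head slot, then no correct process that has delivered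
the same proposals is ahead of it. -/
theorem head_le_of_peek (h : IsExecution correct B F R) (hp : p ∈ correct) (hu : u ∈ correct)
    (hb : (R.state t p).batches = (R.state t' u).batches)
    (hX : ((R.state t' u).queues j).peek = some X) :
    ((R.state t p).queues j).head ≤ ((R.state t' u).queues j).head := by
  by_contra hlt
  obtain ⟨Y, hY, t₁, -, w, hoY⟩ := h.exists_vcbcOut_of_removed hp
    (PQueue.eq_removed_of_lt_head (not_le.mp hlt))
  obtain ⟨hX', t₂, -, w', hoX⟩ := h.exists_vcbcOut_of_full hu (PQueue.peek_eq_some_iff.mp hX)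
  obtain rfl := h.vcbc.consistency p hp u hu _ _ _ _ _ _ _ _ hoY hoX
  exact hX' (hb ▸ hY)

theorem head_eq_of_peek (h : IsExecution correct B F R) (hp : p ∈ correct) (hu : u ∈ correct)
    (hb : (R.state t p).batches = (R.state t' u).batches)
    (hX : ((R.state t' u).queues j).peek = some X) {Y : Finset M}
    (hY : ((R.state t p).queues j).peek = some Y) :
    ((R.state t p).queues j).head = ((R.state t' u).queues j).head :=
  le_antisymm (h.head_le_of_peek hp hu hb hX) (h.head_le_of_peek hu hp hb.symm hY)

theorem eq_of_peek (h : IsExecution correct B F R) (hp : p ∈ correct) (hu : u ∈ correct)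
    (hb : (R.state t p).batches = (R.state t' u).batches)
    (hX : ((R.state t' u).queues j).peek = some X) {Y : Finset M}
    (hY : ((R.state t p).queues j).peek = some Y) : X = Y := by
  have hh := h.head_eq_of_peek hp hu hb hX hY
  obtain ⟨-, t₁, -, w, hoX⟩ := h.exists_vcbcOut_of_full hu (PQueue.peek_eq_some_iff.mp hX)
  obtain ⟨-, t₂, -, w', hoY⟩ := h.exists_vcbcOut_of_full hp (PQueue.peek_eq_some_iff.mp hY)
  rw [hh] at hoY
  exact h.vcbc.consistency u hu p hp _ _ _ _ _ _ _ _ hoX hoY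

end Compare

/-- Correct processes in the same round have delivered the same proposals. -/
theorem batches_agree (h : IsExecution correct B F R) {p q : Fin N} (hp : p ∈ correct)
    (hq : q ∈ correct) {r t t' : ℕ} (ht : (R.state t p).round = r)
    (ht' : (R.state t' q).round = r) : (R.state t p).batches = (R.state t' q).batches := by
  induction r generalizing p q t t' with
  | zero =>
    have h0 : ∀ p ∈ correct, (R.state 0 p).round = 0 ∧ (R.state 0 p).batches = ∅ := by
      intro p hp
      rw [h.follows.start p hp]
      exact ⟨rfl, rfl⟩
    rw [h.follows.batches_eq_of_round_eq hp (ht.trans (h0 p hp).1.symm),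
      h.follows.batches_eq_of_round_eq hq (ht'.trans (h0 q hq).1.symm), (h0 p hp).2, (h0 q hq).2]
  | succ r ih =>
    obtain ⟨t₁, -, hr₁, hc₁⟩ := h.follows.exists_round_end hp ht
    obtain ⟨t₂, -, hr₂, hc₂⟩ := h.follows.exists_round_end hq ht'
    have hagree : ∀ {b b' : Bool}, (R.state t₁ p).decision r = some b →
        (R.state t₂ q).decision r = some b' → b = b' := by
      intro b b' hb hb'
      obtain ⟨_, -, k, hk⟩ := (h.decision_eq_some_iff hp).mp hb
      obtain ⟨_, -, k', hk'⟩ := (h.decision_eq_some_iff hq).mp hb'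
      exact h.aba.agreement p hp q hq r k k' b b' _ _ hk hk'
    have htrue₁ := h.decision_eq_true_of_waitValue hp t₁
    have htrue₂ := h.decision_eq_true_of_waitValue hq t₂
    rw [hr₁] at htrue₁
    rw [hr₂] at htrue₂
    rcases hc₁ with ⟨hd₁, hb₁⟩ | ⟨hw₁, V₁, hV₁, hb₁, -⟩ <;>
      rcases hc₂ with ⟨hd₂, hb₂⟩ | ⟨hw₂, V₂, hV₂, hb₂, -⟩
    · rw [hb₁, hb₂, ih hp hq hr₁ hr₂]
    · exact absurd (hagree hd₁ (htrue₂ hw₂)) (by simp)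
    · exact absurd (hagree (htrue₁ hw₁) hd₂) (by simp)
    · have := h.eq_of_peek hp hq (ih hp hq hr₁ hr₂) hV₂ hV₁
      rw [hb₁, hb₂, ih hp hq hr₁ hr₂, this]

/-! ### Progress of the rounds -/

/-- A correct process that starts a round proposes in it. -/
theorem exists_abaIn (h : IsExecution correct B F R) (hp : p ∈ correct) {t r : ℕ}
    (hr : (R.state t p).round = r) (hph : (R.state t p).phase = Phase.start) :
    ∃ t' ≥ t, (∃ b, R.Does B F t' p (Action.abaIn r b)) ∧ (R.state (t' + 1) p).round = r ∧
      (R.state (t' + 1) p).phase = Phase.waitABA := by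
  obtain ⟨t', htt, ⟨hpr, he⟩, hr', hph'⟩ := h.follows.exists_tick hp t
  rw [hph] at hph'
  rw [hr] at hr'
  have hs : onTick F (R.state t' p) = ({ R.state t' p with phase := Phase.waitABA },
        [Action.abaIn (R.state t' p).round
          ((R.state t' p).queues (F (R.state t' p).round)).peek.isSome]) := by
    simp [onTick, hph']
  refine ⟨t', htt, ⟨((R.state t' p).queues (F r)).peek.isSome, hpr, ?_⟩, ?_, ?_⟩
  · rw [he]
    simp only [step, hs, hr', List.mem_singleton]
  · rw [h.follows.next p hp t' hpr, he]
    simp only [step, hs, hr']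
  · rw [h.follows.next p hp t' hpr, he]
    simp only [step, hs]

/-- Recovery: if a correct process waits for a value in its head slot, then all instances up to
the head slot of a correct process that has proposed `1` in this round eventually output, because
that process answers the `FILL-GAP` request. -/
theorem exists_vcbcOut_of_fillGap (h : IsExecution correct B F R) (hp : p ∈ correct)
    {u : Fin N} (hu : u ∈ correct) {t t' : ℕ} {j : Fin N} {X : Finset M} (htt : t' < t)
    (hX : ((R.state t' u).queues j).peek = some X)
    (hsend : R.Does B F t p (Action.send u (Msg.fillGap j ((R.state t p).queues j).head)))
    {s : ℕ} (hs : s ≤ ((R.state t' u).queues j).head) :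
    ∃ t'' V w, R.Occurs t'' p (Event.vcbcOut j s V w) := by
  by_cases hlt : s < ((R.state t p).queues j).head
  · obtain ⟨V, -, t'', -, w, ho⟩ :=
      h.exists_vcbcOut_of_removed hp (PQueue.eq_removed_of_lt_head hlt)
    exact ⟨t'', V, w, ho⟩
  obtain ⟨t₁, ht₁, hpr₁, he₁⟩ := h.links.reliable p hp u hu t _ hsend
  obtain ⟨t₀, ht₀, V, w, ho⟩ := h.exists_vcbcOut hu (PQueue.ne_empty_of_le_head hX hs)
  have hw : (R.state t₁ u).proof j s = some w :=
    (h.proof_eq_some_iff hu).mpr ⟨t₀, by omega, V, ho⟩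
  have hhead := h.follows.head_mono hu (show t' ≤ t₁ by omega) j
  obtain ⟨l, hl, hmem⟩ : ∃ l : List (Fin N × ℕ × W),
      R.Does B F t₁ u (Action.send p (Msg.filler l)) ∧ (j, s, w) ∈ l := by
    refine ⟨(List.range' ((R.state t p).queues j).head (((R.state t₁ u).queues j).head + 1 -
        ((R.state t p).queues j).head)).filterMap
        (fun s' => ((R.state t₁ u).proof j s').map (fun w => (j, s', w))), ⟨hpr₁, ?_⟩, ?_⟩
    · rw [he₁]
      simp only [step, onFillGap]
      rw [if_pos (by omega)]
      exact List.mem_singleton.mpr rfl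
    · rw [List.mem_filterMap]
      refine ⟨s, ?_, by simp [hw]⟩
      rw [List.mem_range'_1]
      omega
  obtain ⟨t₂, ht₂, hpr₂, he₂⟩ := h.links.reliable u hu p hp t₁ _ hl
  have hproof : R.Does B F t₂ p (Action.vcbcProof j s w) := by
    refine ⟨hpr₂, ?_⟩
    rw [he₂]
    simp only [step, onFiller, List.mem_map]
    exact ⟨(j, s, w), hmem, rfl⟩
  obtain ⟨t₃, w', ho'⟩ :=
    h.vcbc.verifiability u hu p hp j s V w t₀ t₂ (by omega) ho hproof
  exact ⟨t₃, V, w', ho'⟩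

/-- Finitely many instances that all output eventually have all output at some time. -/
theorem exists_forall_slot_ne_empty (h : IsExecution correct B F R) (hp : p ∈ correct) {j : Fin N}
    {n : ℕ} (ho : ∀ s ≤ n, ∃ t V w, R.Occurs t p (Event.vcbcOut j s V w)) :
    ∃ T, ∀ t ≥ T, ∀ s ≤ n, (R.state t p).queues j s ≠ Slot.empty := by
  have hev : ∀ s ∈ Set.Iic n, ∀ᶠ t in atTop, (R.state t p).queues j s ≠ Slot.empty := by
    intro s hs
    obtain ⟨t, V, w, hV⟩ := ho s hs
    filter_upwards [eventually_gt_atTop t] with t' ht'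
    exact h.slot_ne_empty hp hV ht'
  exact eventually_atTop.mp ((eventually_all_finite (Set.finite_Iic n)).mpr hev)

/-- A correct process that waits in round `r` until `C` holds, and for which `C` holds forever from
some time `T` on, ends the wait. -/
theorem exists_end_of_wait (h : IsExecution correct B F R) (hp : p ∈ correct) {t r T : ℕ}
    {ph : Phase} {C : LState N M W → Prop} {D : Prop}
    (hr : (R.state t p).round = r) (hph : (R.state t p).phase = ph)
    (hC : ∀ t ≥ T, (R.state t p).round = r → C (R.state t p))
    (hend : ∀ t, R.Occurs t p Event.tick → (R.state t p).round = r →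
      (R.state t p).phase = ph → C (R.state t p) → D)
    (hwait : ∀ t, R.Occurs t p Event.tick → (R.state t p).round = r →
      (R.state t p).phase = ph → ¬ C (R.state t p) → R.state (t + 1) p = R.state t p) : D := by
  by_contra hD
  have hstay : ∀ n, ∃ t' ≥ n, (R.state t' p).round = r ∧ (R.state t' p).phase = ph := by
    intro n
    induction n with
    | zero => exact ⟨t, Nat.zero_le t, hr, hph⟩
    | succ n ih =>
      obtain ⟨t₁, ht₁, hr₁, hph₁⟩ := ih
      obtain ⟨t₂, ht₂, htick, hr₂, hph₂⟩ := h.follows.exists_tick hp t₁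
      rw [hr₁] at hr₂
      rw [hph₁] at hph₂
      refine ⟨t₂ + 1, by omega, ?_⟩
      rw [hwait t₂ htick hr₂ hph₂ (fun hc => hD (hend t₂ htick hr₂ hph₂ hc))]
      exact ⟨hr₂, hph₂⟩
  obtain ⟨t₁, ht₁, hr₁, hph₁⟩ := hstay T
  obtain ⟨t₂, ht₂, htick, hr₂, hph₂⟩ := h.follows.exists_tick hp t₁
  rw [hr₁] at hr₂
  rw [hph₁] at hph₂
  exact hD (hend t₂ htick hr₂ hph₂ (hC t₂ (by omega) hr₂))

theorem state_succ_of_tick (h : IsExecution correct B F R) (hp : p ∈ correct) {t : ℕ}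
    (ht : R.Occurs t p Event.tick) : R.state (t + 1) p = (onTick F (R.state t p)).1 := by
  rw [h.follows.next p hp t ht.1, ht.2]
  rfl

theorem exists_next_of_waitValue (h : IsExecution correct B F R) (hp : p ∈ correct) {t r T : ℕ}
    (hr : (R.state t p).round = r) (hph : (R.state t p).phase = Phase.waitValue)
    (hT : ∀ t ≥ T, (R.state t p).round = r → ((R.state t p).queues (F r)).peek.isSome) :
    ∃ t', (R.state t' p).round = r + 1 ∧ (R.state t' p).phase = Phase.start := by
  refine h.exists_end_of_wait hp (C := fun σ => (σ.queues (F r)).peek.isSome) hr hph hT ?_ ?_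
  · intro t ht hr hph hC
    obtain ⟨V, hV⟩ := Option.isSome_iff_exists.mp hC
    refine ⟨t + 1, ?_⟩
    rw [h.state_succ_of_tick hp ht]
    simp [onTick, hph, hr, hV]
  · intro t ht hr hph hC
    rw [h.state_succ_of_tick hp ht]
    simp only [Bool.not_eq_true, Option.isSome_eq_false_iff, Option.isNone_iff_eq_none] at hC
    simp [onTick, hph, hr, hC]

/-- A correct process that has proposed in a round and decides in it ends this round. After a
decision `1` some correct process has proposed `1`; the queue of the waiting process eventually
catches up with the queue of that process. -/
theorem exists_next_of_waitABA (h : IsExecution correct B F R) (hp : p ∈ correct) {t r : ℕ}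
    (hr : (R.state t p).round = r) (hph : (R.state t p).phase = Phase.waitABA)
    (hdec : ∃ t k b, R.Occurs t p (Event.abaOut r k b)) :
    ∃ t', (R.state t' p).round = r + 1 ∧ (R.state t' p).phase = Phase.start := by
  obtain ⟨t₀, k, b, hocc⟩ := hdec
  refine h.exists_end_of_wait hp (T := t₀ + 1) (C := fun σ => σ.decision r = some b) hr hph
    (fun t ht _ => (h.decision_eq_some_iff hp).mpr ⟨t₀, ht, k, hocc⟩) ?_ ?_
  · intro t ht hr hph hC
    cases b with
    | false =>
      refine ⟨t + 1, ?_⟩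
      rw [h.state_succ_of_tick hp ht]
      simp [onTick, hph, hr, hC]
    | true =>
      obtain ⟨u, hu, t', htt, hru, hX⟩ := h.exists_proposer hp hC
      obtain ⟨X, hX⟩ := Option.isSome_iff_exists.mp hX
      have hout : ∀ s ≤ ((R.state t' u).queues (F r)).head,
          ∃ t'' V w, R.Occurs t'' p (Event.vcbcOut (F r) s V w) := by
        intro s hs
        cases hY : ((R.state t p).queues (F r)).peek with
        | some Y =>
          have hb := h.batches_agree hp hu hr hru
          rw [← h.head_eq_of_peek hp hu hb hX hY] at hs
          obtain ⟨t'', -, V, w, ho⟩ := h.exists_vcbcOut hp (PQueue.ne_empty_of_le_head hY hs)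
          exact ⟨t'', V, w, ho⟩
        | none =>
          refine h.exists_vcbcOut_of_fillGap hp hu htt hX ⟨ht.1, ?_⟩ hs
          rw [ht.2]
          simp [step, onTick, hph, hr, hC, hY]
      obtain ⟨T, hT⟩ := h.exists_forall_slot_ne_empty hp hout
      refine h.exists_next_of_waitValue hp (t := t + 1) (T := T) ?_ ?_ ?_
      · rw [h.state_succ_of_tick hp ht]
        simp [onTick, hph, hr, hC]
      · rw [h.state_succ_of_tick hp ht]
        simp [onTick, hph, hr, hC]
      · intro t₁ ht₁ hr₁
        rw [(h.follows.bounded hp t₁ (F r)).peek_isSome_iff]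
        exact hT t₁ ht₁ _ (h.head_le_of_peek hp hu (h.batches_agree hp hu hr₁ hru) hX)
  · intro t ht hr hph hC
    rw [h.state_succ_of_tick hp ht]
    cases hd : (R.state t p).decision r with
    | none => simp [onTick, hph, hr, hd]
    | some b' =>
      obtain ⟨t₁, -, k', hk'⟩ := (h.decision_eq_some_iff hp).mp hd
      obtain rfl := h.aba.agreement p hp p hp r k' k b' b t₁ t₀ hk' hocc
      exact absurd hd hC

end IsExecution

/-- Every instance of ABA in which all correct processes take part terminates at all of them. -/
def ABATerminates (correct : Finset (Fin N)) (B : ℕ) (F : ℕ → Fin N) (R : Run N M W) : Prop :=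
  ∀ p ∈ correct, ∀ r, (∀ q ∈ correct, ∃ t b, R.Does B F t q (Action.abaIn r b)) →
    ∃ t k b, R.Occurs t p (Event.abaOut r k b)

theorem ABATermination.ae_terminates {Ω : Type*} [MeasurableSpace Ω] {μ : Measure Ω}
    {E : Ω → Run N M W} (h : ABATermination μ correct B F E) :
    ∀ᵐ ω ∂μ, ABATerminates correct B F (E ω) := by
  simp only [ABATerminates]
  rw [ae_all_iff]
  intro p
  rw [eventually_imp_distrib_left]
  intro hp
  rw [ae_all_iff]
  intro r
  rw [ae_iff, ← nonpos_iff_eq_zero]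
  refine ge_of_tendsto' (h p hp r) fun k => measure_mono fun ω hω => ?_
  simp only [Set.mem_ofPred_eq, Classical.not_imp] at hω ⊢
  refine ⟨hω.1, ?_⟩
  rintro ⟨t, k', -, b, hocc⟩
  exact hω.2 ⟨t, k', b, hocc⟩

namespace IsExecution

theorem exists_round_start (h : IsExecution correct B F R) (hterm : ABATerminates correct B F R)
    (r : ℕ) : ∀ p ∈ correct, ∃ t, (R.state t p).round = r ∧ (R.state t p).phase = Phase.start := by
  induction r with
  | zero =>
    intro p hp
    refine ⟨0, ?_⟩
    rw [h.follows.start p hp]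
    exact ⟨rfl, rfl⟩
  | succ r ih =>
    have hin : ∀ q ∈ correct, ∃ t b, R.Does B F t q (Action.abaIn r b) := by
      intro q hq
      obtain ⟨t, hr, hph⟩ := ih q hq
      obtain ⟨t', -, ⟨b, hb⟩, -⟩ := h.exists_abaIn hq hr hph
      exact ⟨t', b, hb⟩
    intro p hp
    obtain ⟨t, hr, hph⟩ := ih p hp
    obtain ⟨t', -, -, hr', hph'⟩ := h.exists_abaIn hp hr hph
    exact h.exists_next_of_waitABA hp hr' hph' (hterm p hp r hin)

/-! ### Validity -/

/-- If `V` with `m ∈ V` is input to `VCBC (p, s)` and nobody delivers `m`, then eventually the head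
slot of the queue of `p` is full at all correct processes, at or below slot `s`. Each later round
of this queue then decides `1` and removes a head slot, so that the head eventually passes `s`. -/
theorem delivers_of_broadcasts (h : IsExecution correct B F R)
    (hterm : ABATerminates correct B F R) (hF : ∀ (j : Fin N) (r : ℕ), ∃ r' ≥ r, F r' = j)
    (hp : p ∈ correct) {m : M} (hm : R.Broadcasts B F p m) :
    ∃ q ∈ correct, R.Delivers B F q m := by
  by_contra! hno
  obtain ⟨t₀, s, V, hmV, hV⟩ := hm
  have hin : ∀ s' ≤ s, ∃ t V, R.Does B F t p (Action.vcbcIn s' V) := by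
    intro s' hs'
    obtain ⟨_, -, -, hs⟩ := step_vcbcIn hV.2
    rcases hs'.eq_or_lt with rfl | hlt
    · exact ⟨t₀, V, hV⟩
    · exact h.follows.exists_vcbcIn_of_lt_priority hp (t := t₀) (hs ▸ hlt)
  have hused : ∀ q ∈ correct, ∀ᶠ t in atTop, ∀ s' ≤ s,
      (R.state t q).queues p s' ≠ Slot.empty := by
    intro q hq
    refine eventually_atTop.mpr (h.exists_forall_slot_ne_empty hq fun s' hs' => ?_)
    obtain ⟨t, V', hV'⟩ := hin s' hs'
    obtain ⟨t', w, ho⟩ := h.vcbc.validity p hp s' V' t hV' q hq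
    exact ⟨t', V', w, ho⟩
  have hhead : ∀ q ∈ correct, ∀ t, ((R.state t q).queues p).head ≤ s := by
    intro q hq t
    refine PQueue.head_le_of_ne_removed fun hrem => ?_
    obtain ⟨V', hb, t', -, w, ho'⟩ := h.exists_vcbcOut_of_removed hq hrem
    obtain ⟨t'', w', ho⟩ := h.vcbc.validity p hp s V t₀ hV q hq
    obtain rfl := h.vcbc.consistency q hq q hq _ _ _ _ _ _ _ _ ho ho'
    exact hno q hq (h.follows.delivers_of_mem_batches hq hb hmV)
  obtain ⟨T, hT⟩ := eventually_atTop.mp ((Finset.eventually_all correct).mpr hused)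
  have hpeek : ∀ q ∈ correct, ∀ t ≥ T, ((R.state t q).queues p).peek.isSome := by
    intro q hq t ht
    rw [(h.follows.bounded hq t p).peek_isSome_iff]
    exact hT t ht q hq _ (hhead q hq t)
  have hgrow : ∀ n, ∃ t ≥ T, n ≤ ((R.state t p).queues p).head := by
    intro n
    induction n with
    | zero => exact ⟨T, le_rfl, Nat.zero_le _⟩
    | succ n ih =>
      obtain ⟨t, ht, hn⟩ := ih
      -- A round of the queue of `p` that no correct process has started at time `t`.
      obtain ⟨r, hr, hFr⟩ := hF p (correct.sup (fun q => (R.state t q).round) + 1)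
      have hlate : ∀ q ∈ correct, ∀ t', (R.state t' q).round = r → t ≤ t' := by
        intro q hq t' hr'
        by_contra hlt
        have h1 := h.follows.round_mono hq (show t' ≤ t by omega)
        have h2 := Finset.le_sup (f := fun q => (R.state t q).round) hq
        omega
      obtain ⟨t₁, hr₁, -⟩ := h.exists_round_start hterm (r + 1) p hp
      obtain ⟨t₂, -, hr₂, ⟨hd, -⟩ | ⟨-, V', hV', -, hq⟩⟩ := h.follows.exists_round_end hp hr₁
      · obtain ⟨u, hu, t₃, -, hr₃, hfalse⟩ := h.exists_proposer hp hd
        have htrue := hpeek u hu t₃ (ht.trans (hlate u hu t₃ hr₃))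
        rw [hFr, htrue] at hfalse
        simp at hfalse
      · rw [hFr] at hV'
        have ht₂ := hlate p hp t₂ hr₂
        have hmono := h.follows.head_mono hp ht₂ p
        refine ⟨t₂ + 1, by omega, ?_⟩
        have hlt : ((R.state t₂ p).queues p).head < ((R.state (t₂ + 1) p).queues p).head := by
          refine (h.follows.bounded hp (t₂ + 1) p).lt_head fun s' hs' => ?_
          rw [hq]
          rcases hs'.eq_or_lt with rfl | hs'
          · simp [PQueue.dequeue, PQueue.peek_eq_some_iff.mp hV']
          · exact PQueue.dequeue_apply_of_eq_removed V' (PQueue.eq_removed_of_lt_head hs')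
        omega
  obtain ⟨t, -, ht⟩ := hgrow (s + 1)
  have := hhead p hp t
  omega

end IsExecution

end Alea

theorem mainTheorem2 {N : ℕ} {M W Ω : Type*} [MeasurableSpace Ω]
    (μ : Measure Ω) [IsProbabilityMeasure μ]
    (B : ℕ) (F : ℕ → Fin N) (hF : ∀ (j : Fin N) (r : ℕ), ∃ r' ≥ r, F r' = j)
    (correct : Finset (Fin N)) (hfaulty : correctᶜ.card ≤ (N - 1) / 3)
    (E : Ω → Alea.Run N M W)
    (hexec : ∀ᵐ ω ∂μ, Alea.IsExecution correct B F (E ω))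
    (hterm : Alea.ABATermination μ correct B F E) :
    ∀ᵐ ω ∂μ, ∀ p ∈ correct, ∀ m : M,
      ((E ω).Broadcasts B F p m ∨ (E ω).Submits B F p m) →
        ∃ q ∈ correct, (E ω).Delivers B F q m := by
  filter_upwards [hexec, hterm.ae_terminates] with ω h hω p hp m hm
  rcases hm with hm | hm
  · exact h.delivers_of_broadcasts hω hF hp hm
  · rcases h.follows.broadcasts_or_delivers_of_submits hp hm with hb | hd
    · exact h.delivers_of_broadcasts hω hF hp hb
    · exact ⟨p, hp, hd⟩
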